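/- A variety is a class of algebras of a fixed signature that is defined by a set of identities. Let $n\ge 2$ and let $\mathcal V$ be a variety with a strong $n$-cube term $q_n$. This is a $(2^n-1)$-ary term, with arguments indexed by $\{0,1\}^n\setminus\{(1,\dots,1)\}$ (in the order $(0,\dots,0),(1,0,\dots,0),\dots,(0,1,\dots,1)$), such that for every direction $j\in\{1,\dots,n\}$, every $\mathbf A\in\mathcal V$ and every $x\colon\{0,1\}^n\to A$ that does not depend on its $j$-th coordinate, $$q_n^{\mathbf A}\bigl((x_s)_{s\ne(1,\dots,1)}\bigr)=x_{(1,\dots,1)}.$$ An algebra $\mathbf A$ is supernilpotent of degree $d$ if its $(d+1)$-ary higher commutator (in the sense of Bulatov) satisfies $[1_{\mathbf A},\dots,1_{\mathbf A}]=0_{\mathbf A}$. Then for every $d\ge 1$ the class of all algebras in $\mathcal V$ that are supernilpotent of degree $d$ is a subvariety of $\mathcal V$. For $d=n-1$ this subvariety is defined, within $\mathcal V$, by the collection of all identities $$q_n\bigl(t(\mathbf x_1,\dots,\mathbf x_n),\,t(\mathbf y_1,\mathbf x_2,\dots,\mathbf x_n),\,\dots,\,t(\mathbf x_1,\mathbf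 y_2,\dots,\mathbf y_n)\bigr)\approx t(\mathbf y_1,\mathbf y_2,\dots,\mathbf y_n),$$ where $k_1,\dots,k_n$ are positive integers, $t$ is a term of arity $k=k_1+\dots+k_n$, and $\mathbf x_i=(x_{i1},\dots,x_{ik_i})$, $\mathbf y_i=(y_{i1},\dots,y_{ik_i})$ are tuples of distinct variables. Here the argument of $q_n$ with index $s$ is the term $t(\mathbf z_1,\dots,\mathbf z_n)$ with $\mathbf z_i=\mathbf y_i$ if $s_i=1$ and $\mathbf z_i=\mathbf x_i$ if $s_i=0$. -/

import Mathlib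

universe u v w

namespace UniversalAlgebra

/-! ### Identities and varieties

An algebraic signature is a first-order language without relation symbols, and an algebra is a
structure of that language. -/

/-- An identity `lhs ≈ rhs` between two terms over a common set of variables. -/
structure Identity (L : FirstOrder.Language.{u, v}) where
  vars : Type
  lhs : L.Term vars
  rhs : L.Term vars

/-- The algebra `A` satisfies the identity `e`. -/
def Satisfies {L : FirstOrder.Language.{u, v}} (A : Type w) [L.Structure A] (e : Identity L) : Prop :=
  ∀ x : e.vars → A, e.lhs.realize x = e.rhs.realize x

/-- A class of algebras of signature `L`. -/
abbrev AlgebraClass (L : FirstOrder.Language.{u, v}) := (A : Type w) → [L.Structure A] → Prop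

/-- A variety: the class of all algebras that satisfy some given set of identities. -/
def IsVariety {L : FirstOrder.Language.{u, v}} (V : AlgebraClass.{u, v, w} L) : Prop :=
  ∃ E : Set (Identity L), ∀ (A : Type w) [L.Structure A], V A ↔ ∀ e ∈ E, Satisfies A e

/-! ### Congruences and higher commutators -/

/-- A congruence of the algebra `A`: an equivalence relation compatible with all operations. -/
structure Congruence (L : FirstOrder.Language.{u, v}) (A : Type w) [L.Structure A] extends Setoid A where
  compatible : ∀ {n : ℕ} (f : L.Functions n) (x y : Fin n → A),
    (∀ i, r (x i) (y i)) → r (FirstOrder.Language.Structure.funMap f x) (FirstOrder.Language.Structure.funMap f y)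

section

variable {L : FirstOrder.Language.{u, v}} {A : Type w} [L.Structure A]

/-- The largest congruence `1_A`. -/
instance : Top (Congruence L A) where
  top := { toSetoid := ⊤, compatible := fun _ _ _ _ => trivial }

/-- The smallest congruence `0_A`. -/
instance : Bot (Congruence L A) where
  bot := { toSetoid := ⊥
           compatible := fun f x y h => by
             have hxy : x = y := funext h
             subst hxy
             exact Setoid.refl' ⊥ _ }

/-- Given two families `a`, `b` arranged in blocks indexed by `Fin n`, the block `i` is taken
from `b` if `s i = true` and from `a` if `s i = false`. -/
def blend {n : ℕ} {k : Fin n → ℕ} (a b : (Σ i, Fin (k i)) → A) (s : Fin n → Bool) :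
    (Σ i, Fin (k i)) → A :=
  fun p => if s p.1 then b p else a p

/-- `α 0, …, α (n - 1)` centralize `α n` modulo `δ`: for all terms `t` in blocks of variables
and all tuples `a i ≡ b i` modulo `α i`, if
`t (x 0, …, x (n - 1), a n) ≡ t (x 0, …, x (n - 1), b n)` modulo `δ` for all choices of
`x i ∈ {a i, b i}` other than `x i = b i` for all `i`, then the same congruence holds for the
remaining choice `x i = b i` for all `i`. -/
def Centralizes {n : ℕ} (α : Fin (n + 1) → Congruence L A) (δ : Congruence L A) : Prop :=
  ∀ (k : Fin (n + 1) → ℕ), (∀ i, 0 < k i) →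
    ∀ (t : L.Term (Σ i, Fin (k i))) (a b : (Σ i, Fin (k i)) → A),
      (∀ p, (α p.1).r (a p) (b p)) →
      (∀ s : Fin n → Bool, s ≠ (fun _ => true) →
        δ.r (t.realize (blend a b (Fin.snoc (α := fun _ => Bool) s false)))
          (t.realize (blend a b (Fin.snoc (α := fun _ => Bool) s true)))) →
      δ.r (t.realize (blend a b (Fin.snoc (α := fun _ => Bool) (fun _ => true) false)))
        (t.realize (blend a b (Fin.snoc (α := fun _ => Bool) (fun _ => true) true)))

/-- Bulatov's higher commutator `[α 0, …, α n]`: the smallest congruence `δ` such that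
`α 0, …, α (n - 1)` centralize `α n` modulo `δ`, obtained as the intersection of all such `δ`. -/
def higherCommutator {n : ℕ} (α : Fin (n + 1) → Congruence L A) : Congruence L A where
  r x y := ∀ δ : Congruence L A, Centralizes α δ → δ.r x y
  iseqv :=
    { refl := fun x δ _ => δ.iseqv.refl x
      symm := fun h δ hδ => δ.iseqv.symm (h δ hδ)
      trans := fun h h' δ hδ => δ.iseqv.trans (h δ hδ) (h' δ hδ) }
  compatible f x y h δ hδ := δ.compatible f x y fun i => h i δ hδ

/-- The intersection defining the commutator is itself one of the congruences intersected. -/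
theorem centralizes_higherCommutator {n : ℕ} (α : Fin (n + 1) → Congruence L A) :
    Centralizes α (higherCommutator α) :=
  fun k hk t a b hab h δ hδ => hδ k hk t a b hab fun s hs => h s hs δ hδ

end

/-- `A` is supernilpotent of degree `n`: the commutator `[1_A, …, 1_A]` of arity `n + 1` is
`0_A`. -/
def IsSupernilpotent (L : FirstOrder.Language.{u, v}) (n : ℕ) (A : Type w) [L.Structure A] : Prop :=
  higherCommutator (fun _ : Fin (n + 1) => (⊤ : Congruence L A)) = ⊥

/-! ### Strong cube terms -/

/-- The `2 ^ n - 1` vertices of the `n`-dimensional cube other than `(1, …, 1)`. -/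
abbrev ProperVertex (n : ℕ) := {s : Fin n → Bool // s ≠ fun _ => true}

/-- The `(2 ^ n - 1)`-ary term `q` is a strong `n`-cube term in `A`: whenever a labelling `x` of
the vertices of the `n`-dimensional cube is constant along all edges of some direction `j`, then
`q`, applied to all labels except the one at `(1, …, 1)`, returns the label at `(1, …, 1)`. -/
def IsStrongCubeTerm {L : FirstOrder.Language.{u, v}} {n : ℕ} (q : L.Term (ProperVertex n))
    (A : Type w) [L.Structure A] : Prop :=
  ∀ (j : Fin n) (x : (Fin n → Bool) → A),
    (∀ s, x (Function.update s j false) = x (Function.update s j true)) →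
      q.realize (fun s : ProperVertex n => x s.1) = x fun _ => true

/-- For a term `t` whose variables come in `n` blocks of sizes `k i`, the identity
`q (t (x_1, …, x_n), t (y_1, x_2, …, x_n), …, t (x_1, y_2, …, y_n)) ≈ t (y_1, …, y_n)`;
the variable `(false, ⟨i, j⟩)` is `x_{ij}` and `(true, ⟨i, j⟩)` is `y_{ij}`. -/
def cubeIdentity {L : FirstOrder.Language.{u, v}} {n : ℕ} (q : L.Term (ProperVertex n)) {k : Fin n → ℕ}
    (t : L.Term (Σ i, Fin (k i))) : Identity L where
  vars := Bool × (Σ i, Fin (k i))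
  lhs := q.subst fun s => t.relabel fun p => (s.1 p.1, p)
  rhs := t.relabel fun p => (true, p)

/-- The collection of the identities `cubeIdentity q t` for all terms `t` and all decompositions
of the variables of `t` into `n` nonempty blocks. -/
def cubeIdentities {L : FirstOrder.Language.{u, v}} {n : ℕ} (q : L.Term (ProperVertex n)) :
    Set (Identity L) :=
  {e | ∃ k : Fin n → ℕ, (∀ i, 0 < k i) ∧ ∃ t : L.Term (Σ i, Fin (k i)), e = cubeIdentity q t}

end UniversalAlgebra

namespace UniversalAlgebra

open FirstOrder.Language FirstOrder.Language.Term

section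

variable {L : FirstOrder.Language.{u, v}} {A : Type w} [L.Structure A]

/-! Supernilpotence of degree `d` says that `1, …, 1` centralize `1` modulo equality, an implication
between equations. A strong cube term of dimension `d + 1` turns it into identities
(`centralizes_of_cubeIdentities`, `cubeIdentities_of_centralizes`): centrality means that the values
of a term on a cube determine the value at the top vertex, and the cube term computes it. The given
`q` has this dimension only for `d = n - 1`; for other `d`, it yields a Mal'cev term, which in turn
yields strong cube terms of every positive dimension. -/

theorem Congruence.ext_iff_rel {C D : Congruence L A} (h : ∀ x y, C.r x y ↔ D.r x y) : C = D := by
  have hs : C.toSetoid = D.toSetoid := Setoid.ext h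
  cases C
  cases D
  cases hs
  rfl

/-- `A` is supernilpotent of degree `n` iff the full congruences centralize each other modulo
equality. -/
theorem isSupernilpotent_iff_centralizes (n : ℕ) :
    IsSupernilpotent L n A ↔
      Centralizes (fun _ : Fin (n + 1) => (⊤ : Congruence L A)) (⊥ : Congruence L A) := by
  constructor
  · intro h
    have hc := centralizes_higherCommutator (fun _ : Fin (n + 1) => (⊤ : Congruence L A))
    rw [IsSupernilpotent] at h
    rwa [h] at hc
  · intro h
    refine Congruence.ext_iff_rel fun x y => ⟨fun hxy => hxy ⊥ h, fun hxy => ?_⟩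
    have hxy : x = y := hxy
    subst hxy
    exact (higherCommutator _).iseqv.refl _

/-! ### Mal'cev terms and strong cube terms of all dimensions -/

/-- The ternary term `p` is a Mal'cev term in `A`. -/
def IsMalcevTerm (p : L.Term (Fin 3)) (A : Type w) [L.Structure A] : Prop :=
  ∀ x y : A, p.realize ![x, y, y] = x ∧ p.realize ![x, x, y] = y

/-- The term obtained from an `n`-ary cube term by putting `x` at the vertex `(0, 1, …, 1)`, `z`
at `(1, 0, 1, …, 1)`, and `y` elsewhere, where the first two directions are `i` and `j`. -/
def malcevTerm {n : ℕ} (q : L.Term (ProperVertex n)) (i j : Fin n) : L.Term (Fin 3) :=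
  q.relabel fun s =>
    if s.1 = Function.update (fun _ => true) i false then 0
    else if s.1 = Function.update (fun _ => true) j false then 2 else 1

/-- A labelling equal to `x` on the edge in direction `l` through the top and to `y` elsewhere does
not depend on `l`, and `q` sees only the lower end of that edge. The two Mal'cev equations are the
cases `l = i` and `l = j`. -/
theorem IsStrongCubeTerm.isMalcevTerm {n : ℕ} {q : L.Term (ProperVertex n)}
    (hq : IsStrongCubeTerm q A) {i j : Fin n} (hij : i ≠ j) :
    IsMalcevTerm (malcevTerm q i j) A := by
  have key : ∀ (l : Fin n) (x y : A), q.realize (fun s : ProperVertex n =>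
      if s.1 = Function.update (fun _ => true) l false then x else y) = x := by
    intro l x y
    have h := hq l (fun s => if ∀ m, m ≠ l → s m = true then x else y) fun s => by
      congr 1
      apply propext
      refine forall_congr' fun m => imp_congr_right fun hm => ?_
      rw [Function.update_of_ne hm, Function.update_of_ne hm]
    simp only [implies_true, if_true] at h
    refine Eq.trans ?_ h
    congr 1
    funext s
    refine if_congr ⟨fun hs m hm => ?_, fun hs => ?_⟩ rfl rfl
    · rw [hs, Function.update_of_ne hm]
    · funext m
      by_cases hm : m = l
      · subst hm
        rw [Function.update_self]
        by_contra hne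
        refine s.2 (funext fun m' => ?_)
        by_cases hm' : m' = m
        · subst hm'
          simpa using hne
        · exact hs m' hm'
      · rw [Function.update_of_ne hm, hs m hm]
  have hne : Function.update (fun _ : Fin n => true) j false ≠
      Function.update (fun _ => true) i false := by
    intro h
    have := congrFun h i
    simp [Function.update_of_ne hij] at this
  intro x y
  constructor
  · rw [malcevTerm, realize_relabel]
    refine Eq.trans ?_ (key i x y)
    congr 1
    funext s
    simp only [Function.comp]
    split_ifs <;> simp
  · rw [malcevTerm, realize_relabel]
    refine Eq.trans ?_ (key j y x)
    congr 1
    funext s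
    simp only [Function.comp]
    by_cases h1 : s.1 = Function.update (fun _ => true) i false
    · simp [h1, hne.symm]
    · by_cases h2 : s.1 = Function.update (fun _ => true) j false
      · simp [h2, hne]
      · simp [h1, h2]

/-- The proper vertex `(b, s)` of the `(n + 1)`-dimensional cube, for a proper vertex `s`. -/
def ProperVertex.cons {n : ℕ} (b : Bool) (s : ProperVertex n) : ProperVertex (n + 1) :=
  ⟨Fin.cons b s.1, fun h => s.2 (funext fun i => by simpa using congrFun h i.succ)⟩

/-- The proper vertex `(0, 1, …, 1)` of the `(n + 1)`-dimensional cube. -/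
def ProperVertex.falseTop (n : ℕ) : ProperVertex (n + 1) :=
  ⟨Fin.cons false fun _ => true, fun h => by simpa using congrFun h 0⟩

/-- From a Mal'cev term, cube terms of every positive dimension. -/
def cubeTerm (p : L.Term (Fin 3)) : (n : ℕ) → L.Term (ProperVertex (n + 1))
  | 0 => .var (ProperVertex.falseTop 0)
  | n + 1 => p.subst
      ![(cubeTerm p n).relabel (ProperVertex.cons true),
        (cubeTerm p n).relabel (ProperVertex.cons false),
        .var (ProperVertex.falseTop (n + 1))]

/-- In the recursion, if `x` is constant in direction `0`, the two faces agree and `p(u, u, z) = z`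
leaves the label at `(0, 1, …, 1)`. In any other direction each face returns its own top label, and
`p(u, z, z) = u` applies. -/
theorem IsMalcevTerm.isStrongCubeTerm_cubeTerm {p : L.Term (Fin 3)} (hp : IsMalcevTerm p A)
    (n : ℕ) : IsStrongCubeTerm (cubeTerm p n) A := by
  induction n with
  | zero =>
    intro j x hx
    have h := hx fun _ => true
    rw [Function.update_eq_self_iff.2 rfl] at h
    rw [← h, cubeTerm, realize_var]
    congr 1
    funext i
    obtain rfl := Fin.fin_one_eq_zero i
    obtain rfl := Fin.fin_one_eq_zero j
    rfl
  | succ n ih =>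
    intro j x hx
    have htop : (Fin.cons true fun _ => true : Fin (n + 2) → Bool) = fun _ => true := by
      funext i
      refine Fin.cases rfl (fun _ => rfl) i
    have hstep : (cubeTerm p (n + 1)).realize (fun s : ProperVertex (n + 2) => x s.1) =
        p.realize ![(cubeTerm p n).realize (fun s : ProperVertex (n + 1) => x (Fin.cons true s.1)),
          (cubeTerm p n).realize (fun s : ProperVertex (n + 1) => x (Fin.cons false s.1)),
          x (Fin.cons false fun _ => true)] := by
      rw [cubeTerm, realize_subst]
      congr 1
      funext i
      fin_cases i
      · exact realize_relabel
      · exact realize_relabel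
      · exact realize_var _ _
    rw [hstep]
    refine Fin.cases (fun hx => ?_) (fun j hx => ?_) j hx
    · have h : ∀ s : Fin (n + 1) → Bool,
          x (Fin.cons false s) = x (Fin.cons true s) := fun s => by
        simpa [Fin.update_cons_zero] using hx (Fin.cons true s)
      simp only [h]
      rw [(hp _ _).2, htop]
    · have h : ∀ b, (cubeTerm p n).realize
          (fun s : ProperVertex (n + 1) => x (Fin.cons b s.1)) = x (Fin.cons b fun _ => true) :=
        fun b => ih j (fun s => x (Fin.cons b s)) fun s => by
          simpa only [Fin.cons_update] using hx (Fin.cons b s)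
      rw [h, h, (hp _ _).1, htop]

/-! ### Supernilpotence and the cube identities -/

theorem satisfies_cubeIdentity_iff {n : ℕ} {q : L.Term (ProperVertex n)} {k : Fin n → ℕ}
    {t : L.Term (Σ i, Fin (k i))} :
    Satisfies A (cubeIdentity q t) ↔ ∀ a b : (Σ i, Fin (k i)) → A,
      q.realize (fun s : ProperVertex n => t.realize (blend a b s.1)) =
        t.realize (blend a b fun _ => true) := by
  have key : ∀ (x : Bool × (Σ i, Fin (k i)) → A) (s : Fin n → Bool),
      (t.relabel fun p => (s p.1, p)).realize x =
        t.realize (blend (fun p => x (false, p)) (fun p => x (true, p)) s) := fun x s => by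
    rw [realize_relabel]
    congr 1
    funext p
    simp only [Function.comp, blend]
    cases s p.1 <;> rfl
  have hsat : Satisfies A (cubeIdentity q t) ↔ ∀ x : Bool × (Σ i, Fin (k i)) → A,
      (q.subst fun s => t.relabel fun p => (s.1 p.1, p)).realize x =
        (t.relabel fun p => (true, p)).realize x := Iff.rfl
  rw [hsat]
  simp only [realize_subst, key]
  constructor
  · intro h a b
    simpa only [key _ fun _ => true, if_true, Bool.false_eq_true, if_false] using
      h fun p => if p.1 then b p.2 else a p.2
  · intro h x
    rw [key x fun _ => true]
    exact h _ _

/-- Centrality for terms whose variables are an arbitrary nonempty finite type, distributed over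
the blocks by a map `f`. -/
theorem Centralizes.of_fintype {n : ℕ}
    (h : Centralizes (fun _ : Fin (n + 1) => (⊤ : Congruence L A)) (⊥ : Congruence L A))
    {ι : Type*} [Fintype ι] [Nonempty ι] (f : ι → Fin (n + 1)) (t : L.Term ι) (a b : ι → A)
    (hs : ∀ s : Fin n → Bool, s ≠ (fun _ => true) →
      t.realize (fun p => if Fin.snoc (α := fun _ => Bool) s false (f p) then b p else a p) =
        t.realize (fun p => if Fin.snoc (α := fun _ => Bool) s true (f p) then b p else a p)) :
    t.realize (fun p => if Fin.snoc (α := fun _ => Bool) (fun _ : Fin n => true) false (f p)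
        then b p else a p) =
      t.realize (fun p => if Fin.snoc (α := fun _ => Bool) (fun _ : Fin n => true) true (f p)
        then b p else a p) := by
  let e := Fintype.equivFin ι
  -- Every block receives a full copy of `ι`, of which `t` uses only the fibre of `f`; thus no block
  -- is empty, even if `f` is not surjective.
  have key : ∀ s : Fin (n + 1) → Bool,
      (t.relabel fun p => (⟨f p, e p⟩ : Σ _ : Fin (n + 1), Fin (Fintype.card ι))).realize
        (blend (fun p => a (e.symm p.2)) (fun p => b (e.symm p.2)) s) =
      t.realize fun p => if s (f p) then b p else a p := fun s => by
    rw [realize_relabel]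
    congr 1
    funext p
    simp [blend]
  rw [← key, ← key]
  refine h (fun _ => Fintype.card ι) (fun _ => Fintype.card_pos) _ _ _ (fun _ => trivial)
    fun s hs' => ?_
  rw [key, key]
  exact hs s hs'

theorem snoc_true_eq_top (n : ℕ) :
    (Fin.snoc (α := fun _ => Bool) (fun _ : Fin n => true) true) = fun _ => true := by
  funext i
  refine Fin.lastCases ?_ (fun i => ?_) i <;> simp

theorem IsStrongCubeTerm.centralizes_of_cubeIdentities {n : ℕ} {q : L.Term (ProperVertex (n + 1))}
    (hq : IsStrongCubeTerm q A) (h : ∀ e ∈ cubeIdentities q, Satisfies A e) :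
    Centralizes (fun _ : Fin (n + 1) => (⊤ : Congruence L A)) (⊥ : Congruence L A) := by
  intro k hk t a b _ hs
  replace hs : ∀ s : Fin n → Bool, s ≠ (fun _ => true) →
      t.realize (blend a b (Fin.snoc (α := fun _ => Bool) s false)) =
        t.realize (blend a b (Fin.snoc (α := fun _ => Bool) s true)) := hs
  change t.realize (blend a b (Fin.snoc (α := fun _ => Bool) (fun _ => true) false)) =
    t.realize (blend a b (Fin.snoc (α := fun _ => Bool) (fun _ => true) true))
  rw [snoc_true_eq_top, ← satisfies_cubeIdentity_iff.1 (h _ ⟨k, hk, t, rfl⟩) a b]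
  -- Resetting the last coordinate to `false` gives a labelling independent of it. By the centrality
  -- hypothesis it agrees with the original one at all proper vertices, so `q` cannot tell them
  -- apart.
  have := hq (Fin.last n)
    (fun s => t.realize (blend a b (Function.update s (Fin.last n) false))) fun s => by simp
  have hupd : Function.update (fun _ => true) (Fin.last n) false =
      Fin.snoc (α := fun _ => Bool) (fun _ : Fin n => true) false := by
    rw [← snoc_true_eq_top, Fin.update_snoc_last]
  rw [← hupd, ← this]
  congr 1
  funext ⟨s, hs'⟩
  obtain ⟨s, c, rfl⟩ : ∃ (s' : Fin n → Bool) (c : Bool),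
      s = Fin.snoc (α := fun _ => Bool) s' c :=
    ⟨Fin.init s, s (Fin.last n), (Fin.snoc_init_self s).symm⟩
  simp only [Fin.update_snoc_last]
  cases c
  · rfl
  · exact hs s fun hst => hs' (by rw [hst, snoc_true_eq_top])

/-- Centrality is applied to `w(s) = p(t(s), q(t(r ∧ s))_r, c)`, where `c = q(t(r))_r`. It equals
`c` at every proper `s`, hence also at the top, where it is `p(t(1, …, 1), c, c) = t(1, …, 1)`. -/
theorem IsStrongCubeTerm.cubeIdentities_of_centralizes {n : ℕ}
    {q : L.Term (ProperVertex (n + 1))} (hq : IsStrongCubeTerm q A) {p : L.Term (Fin 3)}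
    (hp : IsMalcevTerm p A)
    (h : Centralizes (fun _ : Fin (n + 1) => (⊤ : Congruence L A)) (⊥ : Congruence L A)) :
    ∀ e ∈ cubeIdentities q, Satisfies A e := by
  rintro _ ⟨k, -, t, rfl⟩
  rw [satisfies_cubeIdentity_iff]
  intro a b
  let c := q.realize (fun s : ProperVertex (n + 1) => t.realize (blend a b s.1))
  let T : (Fin (n + 1) → Bool) → L.Term (Option ((Fin (n + 1) → Bool) × Σ i, Fin (k i))) :=
    fun r => t.relabel fun v => some (r, v)
  let w : L.Term (Option ((Fin (n + 1) → Bool) × Σ i, Fin (k i))) :=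
    p.subst ![T fun _ => true, q.subst fun r => T r.1, .var none]
  let f : Option ((Fin (n + 1) → Bool) × Σ i, Fin (k i)) → Fin (n + 1) :=
    fun o => o.elim 0 fun v => v.2.1
  -- The variable `none` carries `c` in both tuples, so its block is immaterial. Copy `r` of a
  -- variable moves from `a` to `b` only if `r` is `true` on its block, which makes `T r` at `s` the
  -- value of `t` at `r ∧ s`.
  let a' : Option ((Fin (n + 1) → Bool) × Σ i, Fin (k i)) → A := fun o => o.elim c fun v => a v.2
  let b' : Option ((Fin (n + 1) → Bool) × Σ i, Fin (k i)) → A :=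
    fun o => o.elim c fun v => if v.1 v.2.1 then b v.2 else a v.2
  have hT : ∀ r s : Fin (n + 1) → Bool,
      (T r).realize (fun o => if s (f o) then b' o else a' o) =
        t.realize (blend a b fun i => r i && s i) := fun r s => by
    rw [realize_relabel]
    congr 1
    funext v
    simp only [Function.comp, blend, f, a', b', Option.elim]
    by_cases hr : r v.1 = true <;> by_cases hs : s v.1 = true <;> simp [hr, hs]
  have hw : ∀ s : Fin (n + 1) → Bool, w.realize (fun o => if s (f o) then b' o else a' o) =
      p.realize ![t.realize (blend a b s), q.realize
        (fun r : ProperVertex (n + 1) => t.realize (blend a b fun i => r.1 i && s i)), c] :=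
    fun s => by
      rw [realize_subst]
      congr 1
      funext i
      fin_cases i
      · simpa using hT (fun _ => true) s
      · simp [realize_subst, hT]
      · simp [a', b']
  have hproper : ∀ s : Fin (n + 1) → Bool, s ≠ (fun _ => true) →
      w.realize (fun o => if s (f o) then b' o else a' o) = c := fun s hs => by
    obtain ⟨j, hj⟩ := Function.ne_iff.1 hs
    have hj : s j = false := by simpa using hj
    -- Since `s j = false`, the vertex `r ∧ s` does not depend on `r j`.
    have := hq j (fun r => t.realize (blend a b fun i => r i && s i)) fun r => by
      congr 2
      funext i
      by_cases hi : i = j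
      · subst hi
        simp [hj]
      · simp [Function.update_of_ne hi]
    rw [hw, this]
    simp only [Bool.true_and]
    exact (hp _ _).2
  have hfalse : ∀ s : Fin n → Bool, Fin.snoc (α := fun _ => Bool) s false ≠ fun _ => true :=
    fun s hs => by simpa using congrFun hs (Fin.last n)
  have key := h.of_fintype f w a' b' fun s hs => by
    rw [hproper _ (hfalse s), hproper]
    exact fun hst => hs (funext fun i => by simpa using congrFun hst i.castSucc)
  rw [hproper _ (hfalse _), snoc_true_eq_top] at key
  replace key := key.trans (hw fun _ => true)
  simp only [Bool.and_true] at key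
  exact key.trans (hp _ _).1

theorem IsStrongCubeTerm.isSupernilpotent_iff {n : ℕ} {q : L.Term (ProperVertex (n + 1))}
    (hq : IsStrongCubeTerm q A) {p : L.Term (Fin 3)} (hp : IsMalcevTerm p A) :
    IsSupernilpotent L n A ↔ ∀ e ∈ cubeIdentities q, Satisfies A e :=
  (isSupernilpotent_iff_centralizes n).trans
    ⟨hq.cubeIdentities_of_centralizes hp, hq.centralizes_of_cubeIdentities⟩

end

end UniversalAlgebra

theorem mainTheorem11 (L : FirstOrder.Language.{u, v}) [L.IsAlgebraic]
    (V : UniversalAlgebra.AlgebraClass.{u, v, w} L) (hV : UniversalAlgebra.IsVariety V)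
    (n : ℕ) (hn : 2 ≤ n) (q : L.Term (UniversalAlgebra.ProperVertex n))
    (hq : ∀ (A : Type w) [L.Structure A], V A → UniversalAlgebra.IsStrongCubeTerm q A) :
    (∀ d : ℕ, 1 ≤ d →
      UniversalAlgebra.IsVariety.{u, v, w} (L := L)
        (fun A _ => V A ∧ UniversalAlgebra.IsSupernilpotent L d A)) ∧
    (∀ (A : Type w) [L.Structure A], V A →
      (UniversalAlgebra.IsSupernilpotent L (n - 1) A ↔
        ∀ e ∈ UniversalAlgebra.cubeIdentities q, UniversalAlgebra.Satisfies A e)) := by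
  -- The Mal'cev term needs two distinct directions, here `0` and `1`.
  obtain ⟨n, rfl⟩ : ∃ m, n = m + 2 := ⟨n - 2, by omega⟩
  have hp : ∀ (A : Type w) [L.Structure A], V A →
      UniversalAlgebra.IsMalcevTerm (UniversalAlgebra.malcevTerm q 0 1) A :=
    fun A _ hA => (hq A hA).isMalcevTerm (by simp)
  refine ⟨fun d _ => ?_, fun A _ hA => (hq A hA).isSupernilpotent_iff (hp A hA)⟩
  obtain ⟨E, hE⟩ := hV
  refine ⟨E ∪ UniversalAlgebra.cubeIdentities
    (UniversalAlgebra.cubeTerm (UniversalAlgebra.malcevTerm q 0 1) d), fun A _ => ?_⟩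
  have hd : V A → (UniversalAlgebra.IsSupernilpotent L d A ↔ _) := fun hA =>
    ((hp A hA).isStrongCubeTerm_cubeTerm d).isSupernilpotent_iff (hp A hA)
  refine (and_congr_right hd).trans ?_
  rw [hE A]
  exact ⟨fun h e he => he.elim (h.1 e) (h.2 e),
    fun h => ⟨fun e he => h e (.inl he), fun e he => h e (.inr he)⟩⟩
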